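/- All spaces are metric spaces. A map $f:Y\to X$ is quasi-isometric if there are $a\ge 1$, $b\ge 0$ with $\frac1a d(y,y')-b\le d(f(y),f(y'))\le a\,d(y,y')+b$ for all $y,y'\in Y$ (no continuity is required); it is a quasi-isometry if moreover every point of $X$ lies within a uniformly bounded distance of $f(Y)$, and then $X$ and $Y$ are called quasi-isometric. A space $X$ is QPC if for every quasi-isometric map $f:Y\to X$ from a metric space $Y$ there are a continuous map $f':Y\to X$ and a constant $C<\infty$ with $d(f'(y),f(y))\le C$ for all $y\in Y$. For a compact space $K$, $\dim K$ is the minimal integer $n\ge -1$ such that every open covering of $K$ has a finite closed refinement of multiplicity $\le n+1$ (and $\dim K=\infty$ if there is none; $\dim\emptyset=-1$); for a topological space $X$, $\dim X=\sup\{\dim K: K\subset X\text{ compact}\}$. A maximal $\delta$-separated net $N\subset X$ ($\delta>0$) is a maximal subset with $d(a,a')\ge\delta$ for all distinct $a,a'\in N$. For $\sigma\ge\delta$ and $A\subset X$, let $\mathrm{size}_{N,\sigma}(A)\in\mathbb N\cup\{\infty\}$ be the number of points $x\in N$ whose open ball $B_\sigma(x)$ meets $A$. Fix $x_0\in X$ (the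 choice does not matter). A continuous map $g:X\to T$ to a Hausdorff space $T$ defines a subexponential partition $(X,g,T)$ if, for every maximal $\delta$-separated net $N\subset X$ with $\delta$ sufficiently large, every sufficiently large $\sigma\ge\delta$ and every $\varepsilon>0$, there is $R_0\ge 1$ such that $$\frac1R\ln\mathrm{size}_{N,\sigma}\bigl(g^{-1}(t)\cap\overline B_R(x_0)\bigr)<\varepsilon\quad\text{for all } R\ge R_0\text{ and all } t\in T.$$ Its rank is $\operatorname{rank}(X,g,T)=\sup\{\dim g(K):K\subset X\text{ compact}\}$. The subexponential corank of $X$ is $$\operatorname{corank}X=\sup_{Z}\ \inf\ \operatorname{rank}(Z,g,T),$$ where the supremum is over all metric spaces $Z$ quasi-isometric to $X$ and the infimum is over all subexponential partitions $(Z,g,T)$ of $Z$ (it is $\infty$ if there are none). A Hadamard space is a complete CAT(0) space. For a Hadamard space $Y$, $\partial_\infty Y$ is the set of asymptoty classes of unit speed geodesic rays, with the cone topology. The hyperbolic rank $\operatorname{rank}_hX$ is the supremum of $\dim\partial_\infty Y$ over all locally compact CAT$(-1)$ Hadamard spaces $Y$ that admit a quasi-isometric map $Y\to X$. **Theorem.**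 Let $X$ be a metric space which is quasi-isometric to a QPC space. Then $$\operatorname{rank}_hX\le\operatorname{corank}X.$$ In particular, there is no quasi-isometric map $Y\to X$ from a locally compact CAT$(-1)$ Hadamard space $Y$ with $\dim\partial_\infty Y>\operatorname{corank}X$. Moreover, if $X$ itself is QPC, then it supports no subexponential partition $(X,g,T)$ of rank less than $\operatorname{rank}_hX$. -/

import Mathlib

open scoped NNReal ENNReal

universe u v

noncomputable section

/-! ### Quasi-isometries -/

/-- `f` is a quasi-isometric map (a quasi-isometric embedding; no continuity is required). -/
def IsQuasiIsometricMap {X : Type u} {Y : Type v} [MetricSpace X] [MetricSpace Y]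
    (f : X → Y) : Prop :=
  ∃ a b : ℝ, 1 ≤ a ∧ 0 ≤ b ∧ ∀ x x' : X,
    1 / a * dist x x' - b ≤ dist (f x) (f x') ∧ dist (f x) (f x') ≤ a * dist x x' + b

/-- `A` is a net in `X`: all points of `X` lie within a uniformly bounded distance of `A`. -/
def IsNet {X : Type u} [MetricSpace X] (A : Set X) : Prop :=
  ∃ C : ℝ, ∀ x : X, ∃ a ∈ A, dist x a ≤ C

/-- The spaces `X` and `Y` are quasi-isometric. -/
def QuasiIsometric (X : Type u) (Y : Type v) [MetricSpace X] [MetricSpace Y] : Prop :=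
  ∃ f : X → Y, IsQuasiIsometricMap f ∧ IsNet (Set.range f)

/-- `X` is a QPC space: every quasi-isometric map into `X` is parallel to a continuous one. -/
def IsQPC (X : Type u) [MetricSpace X] : Prop :=
  ∀ (Y : Type u) [MetricSpace Y] (f : Y → X), IsQuasiIsometricMap f →
    ∃ f' : Y → X, Continuous f' ∧ ∃ C : ℝ, ∀ y : Y, dist (f' y) (f y) ≤ C

/-! ### Topological dimension -/

/-- Every open covering of `K` can be refined by a finite closed covering of multiplicity
at most `m` (no point of `K` lies in more than `m` members). -/
def HasClosedRefinements (K : Type u) [TopologicalSpace K] (m : ℕ) : Prop :=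
  ∀ 𝒰 : Set (Set K), (∀ U ∈ 𝒰, IsOpen U) → ⋃₀ 𝒰 = Set.univ →
    ∃ 𝒞 : Set (Set K), 𝒞.Finite ∧ (∀ C ∈ 𝒞, IsClosed C) ∧ ⋃₀ 𝒞 = Set.univ ∧
      (∀ C ∈ 𝒞, ∃ U ∈ 𝒰, C ⊆ U) ∧ ∀ x : K, {C ∈ 𝒞 | x ∈ C}.encard ≤ m

open Classical in
/-- Covering dimension of a compact space `K`: the minimal `n` such that all open coverings have
finite closed refinements of multiplicity at most `n + 1`. The value `⊥` stands for the
dimension `-1` of the empty space, and `⊤` means infinite dimension. -/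
def coverDim (K : Type u) [TopologicalSpace K] : WithBot ℕ∞ :=
  if IsEmpty K then ⊥
  else ⨅ (n : ℕ) (_ : HasClosedRefinements K (n + 1)), ((n : ℕ∞) : WithBot ℕ∞)

/-- Dimension of a topological space: the supremum of the dimensions of its compact subsets. -/
def topDim (X : Type u) [TopologicalSpace X] : WithBot ℕ∞ :=
  ⨆ (K : Set X) (_ : IsCompact K), coverDim K

/-! ### Subexponential partitions and corank -/

/-- `N` is a maximal `δ`-separated subset of `X`. -/
def IsMaximalSeparatedNet {X : Type u} [MetricSpace X] (δ : ℝ) (N : Set X) : Prop :=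
  Maximal (fun A : Set X => A.Pairwise fun a a' => δ ≤ dist a a') N

/-- The size of `A` with respect to `N` and `σ`: the number of points of `N` whose open
`σ`-ball meets `A`. -/
def netSize {X : Type u} [MetricSpace X] (N : Set X) (σ : ℝ) (A : Set X) : ℕ∞ :=
  {x ∈ N | (Metric.ball x σ ∩ A).Nonempty}.encard

/-- The map `g : X → T` defines a subexponential continuous partition of `X` into its fibres.
The logarithm takes values in `[-∞, ∞]`, with `log 0 = -∞` and `log ∞ = ∞`. -/
def IsSubexponentialPartition {X : Type u} {T : Type v} [MetricSpace X] [TopologicalSpace T]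
    (g : X → T) : Prop :=
  Continuous g ∧
    ∀ x₀ : X, ∃ δ₀ > (0 : ℝ), ∀ δ ≥ δ₀, ∀ N : Set X, IsMaximalSeparatedNet δ N →
      ∃ σ₀ : ℝ, ∀ σ ≥ σ₀, δ ≤ σ → ∀ ε > (0 : ℝ), ∃ R₀ ≥ (1 : ℝ), ∀ R ≥ R₀, ∀ t : T,
        ((1 / R : ℝ) : EReal) *
          ENNReal.log (netSize N σ (g ⁻¹' {t} ∩ Metric.closedBall x₀ R) : ℝ≥0∞) < (ε : EReal)

/-- The rank of the partition of `X` given by `g : X → T`. -/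
def partitionRank {X : Type u} {T : Type v} [MetricSpace X] [TopologicalSpace T]
    (g : X → T) : WithBot ℕ∞ :=
  ⨆ (K : Set X) (_ : IsCompact K), coverDim (g '' K)

/-- Infimum of the ranks of the subexponential partitions of `Z` (with Hausdorff target). -/
def minPartitionRank (Z : Type u) [MetricSpace Z] : WithBot ℕ∞ :=
  ⨅ (T : Type u) (_ : TopologicalSpace T) (_ : T2Space T) (g : Z → T)
    (_ : IsSubexponentialPartition g), partitionRank g

/-- The subexponential corank of `X`. -/
def corank (X : Type u) [MetricSpace X] : WithBot ℕ∞ :=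
  ⨆ (Z : Type u) (_ : MetricSpace Z) (_ : QuasiIsometric X Z), minPartitionRank Z

/-! ### CAT(-1) spaces, Hadamard spaces, and the boundary at infinity -/

/-- Any two points of `Y` are joined by a geodesic segment. -/
def IsGeodesicSpace (Y : Type u) [MetricSpace Y] : Prop :=
  ∀ x y : Y, ∃ c : ℝ → Y, c 0 = x ∧ c (dist x y) = y ∧
    ∀ s ∈ Set.Icc 0 (dist x y), ∀ t ∈ Set.Icc 0 (dist x y), dist (c s) (c t) = |s - t|

/-- Geodesic triangles in `Y` are not thicker than their comparison triangles in the model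
plane `M`. Here `p` lies on a side from `x` to `y` and `q` on a side from `x` to `z`;
primed points are the comparison points. (In a geodesic space, `p` lies on some geodesic from
`x` to `y` iff `dist x p + dist p y = dist x y`.) -/
def TrianglesThinnerThan (M : Type v) [MetricSpace M] (Y : Type u) [MetricSpace Y] : Prop :=
  ∀ x y z p q : Y,
    dist x p + dist p y = dist x y → dist x q + dist q z = dist x z →
    ∀ x' y' z' p' q' : M,
      dist x' y' = dist x y → dist y' z' = dist y z → dist x' z' = dist x z →
      dist x' p' = dist x p → dist p' y' = dist p y →
      dist x' q' = dist x q → dist q' z' = dist q z →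
      dist p q ≤ dist p' q'

/-- CAT(0) spaces: comparison with the Euclidean plane. -/
def IsCATZero (Y : Type u) [MetricSpace Y] : Prop :=
  IsGeodesicSpace Y ∧ TrianglesThinnerThan (EuclideanSpace ℝ (Fin 2)) Y

/-- CAT(-1) spaces: comparison with the hyperbolic plane of curvature `-1`. -/
def IsCATNegOne (Y : Type u) [MetricSpace Y] : Prop :=
  IsGeodesicSpace Y ∧ TrianglesThinnerThan UpperHalfPlane Y

/-- Hadamard spaces: complete CAT(0) spaces. -/
def IsHadamard (Y : Type u) [MetricSpace Y] : Prop :=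
  CompleteSpace Y ∧ IsCATZero Y

/-- `Y` is a locally compact CAT(-1) Hadamard space. -/
structure IsLocallyCompactHadamardCATNegOne (Y : Type u) [MetricSpace Y] : Prop where
  locallyCompact : LocallyCompactSpace Y
  hadamard : IsHadamard Y
  catNegOne : IsCATNegOne Y

/-- Unit speed geodesic rays in `Y`. -/
def GeodesicRay (Y : Type u) [MetricSpace Y] : Type u :=
  {c : ℝ≥0 → Y // Isometry c}

/-- Two geodesic rays are asymptotic if they stay within bounded distance of each other. -/
def asymptoticSetoid (Y : Type u) [MetricSpace Y] : Setoid (GeodesicRay Y) where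
  r c c' := ∃ C : ℝ, ∀ t : ℝ≥0, dist (c.1 t) (c'.1 t) ≤ C
  iseqv :=
    { refl := fun c => ⟨0, fun t => by simp⟩
      symm := fun {c c'} ⟨C, h⟩ => ⟨C, fun t => by rw [dist_comm]; exact h t⟩
      trans := fun {c c' c''} ⟨C, h⟩ ⟨D, k⟩ =>
        ⟨C + D, fun t => (dist_triangle _ (c'.1 t) _).trans (add_le_add (h t) (k t))⟩ }

/-- The boundary at infinity `∂_∞ Y`: asymptoty classes of geodesic rays. -/
def BoundaryAtInfinity (Y : Type u) [MetricSpace Y] : Type u :=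
  Quotient (asymptoticSetoid Y)

/-- The cone neighbourhood in `∂_∞ Y` given by `c`, `r` and `ε`: the classes of those rays from
`c 0` that are `ε`-close to `c` at time `r`. -/
def coneNhd {Y : Type u} [MetricSpace Y] (c : GeodesicRay Y) (r : ℝ≥0) (ε : ℝ) :
    Set (BoundaryAtInfinity Y) :=
  {ξ | ∃ c' : GeodesicRay Y, c'.1 0 = c.1 0 ∧ Quotient.mk (asymptoticSetoid Y) c' = ξ ∧
    dist (c'.1 r) (c.1 r) < ε}

/-- The cone topology on `∂_∞ Y`. -/
instance BoundaryAtInfinity.instTopologicalSpace (Y : Type u) [MetricSpace Y] :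
    TopologicalSpace (BoundaryAtInfinity Y) :=
  TopologicalSpace.generateFrom
    {U | ∃ (c : GeodesicRay Y) (r : ℝ≥0) (ε : ℝ), 0 < ε ∧ U = coneNhd c r ε}

/-- The hyperbolic rank of `X`: the supremum of `dim ∂_∞ Y` over all locally compact CAT(-1)
Hadamard spaces `Y` that embed quasi-isometrically into `X`. -/
def hyperbolicRank (X : Type u) [MetricSpace X] : WithBot ℕ∞ :=
  ⨆ (Y : Type u) (_ : MetricSpace Y) (_ : IsLocallyCompactHadamardCATNegOne Y)
    (_ : ∃ f : Y → X, IsQuasiIsometricMap f), topDim (BoundaryAtInfinity Y)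

end

/-! ### Isosceles triangles in the hyperbolic plane -/

namespace UpperHalfPlane

open Real

/-! The obstruction is exponential growth. Let `f : Y → X` be quasi-isometric; if `X` is QPC it may
be taken continuous. The sphere of radius `R` about `y₀` is parametrized by a compact `K ⊆ ∂_∞ Y`
via rays, and `g ∘ f` is restricted to it. If `dim K` exceeded the rank of `g`, some open covering
of `K` would have no refinement of the allowed multiplicity, and Hurewicz's argument
(`HasClosedRefinements.exists_refinement`) would give, for every `R`, a connected part of a fibre
not subordinate to it. Seen at a radius `r` depending only on the covering, this part contains two
points more than `1` apart. By CAT(-1) comparison (`TrianglesThinnerThan.sinh_half_dist_le`), what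
lies in one net ball at radius `R` has diameter of order `1 / sinh R` at radius `r`. Connectedness
then forces at least `κ * sinh R` net balls to meet the fibre, against subexponentiality.

The general case follows because hyperbolic rank is monotone under quasi-isometric maps and corank
is a supremum over the quasi-isometry class. -/

theorem cosh_sub_mul_sinh_pos {s c : ℝ} (h : s ^ 2 + c ^ 2 = 1) (r : ℝ) :
    0 < cosh r - c * sinh r := by
  have h1 : |c * sinh r| < cosh r := by
    refine abs_lt_of_sq_lt_sq ?_ (cosh_pos r).le
    rw [mul_pow, cosh_sq]
    nlinarith [mul_nonneg (sq_nonneg s) (sq_nonneg (sinh r))]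
  linarith [le_abs_self (c * sinh r)]

/-- The point of the hyperbolic plane at distance `r` from `i` in the direction `(s, c)`. -/
noncomputable def polarPoint (s c : ℝ) (h : s ^ 2 + c ^ 2 = 1) (r : ℝ) : UpperHalfPlane :=
  ⟨⟨s * sinh r / (cosh r - c * sinh r), 1 / (cosh r - c * sinh r)⟩,
    one_div_pos.2 (cosh_sub_mul_sinh_pos h r)⟩

/-- The hyperbolic law of cosines at the apex `i`: `s * s' + c * c'` is the cosine of the angle
between the two unit directions. -/
theorem cosh_dist_polarPoint {s c s' c' : ℝ} (h : s ^ 2 + c ^ 2 = 1) (h' : s' ^ 2 + c' ^ 2 = 1)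
    (r r' : ℝ) : cosh (dist (polarPoint s c h r) (polarPoint s' c' h' r')) =
      cosh r * cosh r' - (s * s' + c * c') * (sinh r * sinh r') := by
  have hA := cosh_sub_mul_sinh_pos h r
  have hA' := cosh_sub_mul_sinh_pos h' r'
  have h1 : s ^ 2 * sinh r ^ 2 + 1 = (cosh r - c * sinh r) * (cosh r + c * sinh r) := by
    linear_combination sinh r ^ 2 * h - cosh_sq r
  have h2 : s' ^ 2 * sinh r' ^ 2 + 1 =
      (cosh r' - c' * sinh r') * (cosh r' + c' * sinh r') := by
    linear_combination sinh r' ^ 2 * h' - cosh_sq r'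
  rw [cosh_dist']
  change ((s * sinh r / (cosh r - c * sinh r) - s' * sinh r' / (cosh r' - c' * sinh r')) ^ 2 +
    (1 / (cosh r - c * sinh r)) ^ 2 + (1 / (cosh r' - c' * sinh r')) ^ 2) /
    (2 * (1 / (cosh r - c * sinh r)) * (1 / (cosh r' - c' * sinh r'))) = _
  generalize hAA : cosh r - c * sinh r = A at *
  generalize hAA' : cosh r' - c' * sinh r' = A' at *
  have e : cosh r = A + c * sinh r := by linarith
  have e' : cosh r' = A' + c' * sinh r' := by linarith
  rw [e] at h1 ⊢
  rw [e'] at h2 ⊢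
  field_simp
  linear_combination A' ^ 2 * h1 + A ^ 2 * h2

theorem eq_of_cosh_eq_cosh {a b : ℝ} (ha : 0 ≤ a) (hb : 0 ≤ b) (h : cosh a = cosh b) : a = b :=
  cosh_strictMonoOn.injOn ha hb h

theorem dist_polarPoint_same {s c : ℝ} (h : s ^ 2 + c ^ 2 = 1) {r r' : ℝ} (hr : r ≤ r') :
    dist (polarPoint s c h r) (polarPoint s c h r') = r' - r := by
  refine eq_of_cosh_eq_cosh dist_nonneg (by linarith) ?_
  rw [cosh_dist_polarPoint, cosh_sub]
  linear_combination -(sinh r * sinh r') * h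

theorem dist_polarPoint_zero {s c s' c' : ℝ} (h : s ^ 2 + c ^ 2 = 1) (h' : s' ^ 2 + c' ^ 2 = 1)
    {r : ℝ} (hr : 0 ≤ r) : dist (polarPoint s' c' h' 0) (polarPoint s c h r) = r := by
  refine eq_of_cosh_eq_cosh dist_nonneg hr ?_
  rw [cosh_dist_polarPoint]
  simp

/-- The directions are mirror images, so `s` is the sine of half the apex angle, and the axis of
symmetry cuts the isosceles triangle into two right triangles. -/
theorem sinh_half_dist_polarPoint_neg {s c : ℝ} (hs : 0 ≤ s) (h : s ^ 2 + c ^ 2 = 1)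
    (h' : (-s) ^ 2 + c ^ 2 = 1) {r : ℝ} (hr : 0 ≤ r) :
    sinh (dist (polarPoint s c h r) (polarPoint (-s) c h' r) / 2) = s * sinh r := by
  have h1 := cosh_dist_polarPoint h h' r r
  set d := dist (polarPoint s c h r) (polarPoint (-s) c h' r)
  have h2 : cosh d = 1 + 2 * sinh (d / 2) ^ 2 := by
    have := cosh_two_mul (d / 2)
    rw [mul_div_cancel₀ d (two_ne_zero' ℝ), cosh_sq] at this
    linarith
  have h3 : 0 ≤ sinh (d / 2) := sinh_nonneg_iff.2 (by positivity)
  have h4 : 0 ≤ s * sinh r := mul_nonneg hs (sinh_nonneg_iff.2 hr)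
  refine (sq_eq_sq₀ h3 h4).1 ?_
  have := cosh_sq r
  nlinarith

/-- An isosceles hyperbolic triangle with legs `R` and base `D`, and the points at distance `r`
from the apex on its legs. -/
theorem exists_isosceles {r R D : ℝ} (hr : 0 ≤ r) (hrR : r ≤ R) (hR : 0 < R) (hD : 0 ≤ D)
    (hDR : D ≤ 2 * R) : ∃ x y z p q : UpperHalfPlane,
      dist x y = R ∧ dist x z = R ∧ dist y z = D ∧ dist x p = r ∧ dist p y = R - r ∧
      dist x q = r ∧ dist q z = R - r ∧
      sinh (dist p q / 2) = sinh r / sinh R * sinh (D / 2) := by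
  have hS : 0 < sinh R := sinh_pos_iff.2 hR
  have hSD : 0 ≤ sinh (D / 2) := sinh_nonneg_iff.2 (by positivity)
  -- The sine of half the apex angle, solved from the base length; `D ≤ 2 * R` makes it at most `1`.
  set s := sinh (D / 2) / sinh R with hs
  have hs0 : 0 ≤ s := by positivity
  have hs1 : s ≤ 1 := (div_le_one hS).2 (sinh_le_sinh.2 (by linarith))
  have h : s ^ 2 + √(1 - s ^ 2) ^ 2 = 1 := by
    rw [sq_sqrt (by nlinarith)]; ring
  have h' : (-s) ^ 2 + √(1 - s ^ 2) ^ 2 = 1 := by rw [neg_sq]; exact h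
  refine ⟨polarPoint s _ h 0, polarPoint s _ h R, polarPoint (-s) _ h' R, polarPoint s _ h r,
    polarPoint (-s) _ h' r, dist_polarPoint_zero _ _ hR.le, dist_polarPoint_zero _ _ hR.le, ?_,
    dist_polarPoint_zero _ _ hr, dist_polarPoint_same _ hrR, dist_polarPoint_zero _ _ hr,
    dist_polarPoint_same _ hrR, ?_⟩
  · have := sinh_half_dist_polarPoint_neg hs0 h h' hR.le
    have := sinh_injective (this.trans (div_mul_cancel₀ _ hS.ne'))
    linarith
  · rw [sinh_half_dist_polarPoint_neg hs0 h h' hr, hs]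
    ring

end UpperHalfPlane

/-! ### Exponential contraction in CAT(-1) spaces -/

section Contraction

open Real

variable {Y : Type u} [MetricSpace Y]

/-- In the model plane this is an equality, both sides being governed by the same apex angle. The
factor `sinh r / sinh R` is the source of all exponential estimates below. -/
theorem TrianglesThinnerThan.sinh_half_dist_le (hY : TrianglesThinnerThan UpperHalfPlane Y)
    {x y z p q : Y} {r R : ℝ} (hR : 0 < R) (hxy : dist x y = R) (hxz : dist x z = R)
    (hxp : dist x p = r) (hpy : dist p y = R - r) (hxq : dist x q = r) (hqz : dist q z = R - r) :
    sinh (dist p q / 2) ≤ sinh r / sinh R * sinh (dist y z / 2) := by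
  have hr : 0 ≤ r := hxp ▸ dist_nonneg
  have hrR : r ≤ R := sub_nonneg.1 (hpy ▸ dist_nonneg)
  have hD : dist y z ≤ 2 * R := by
    have := dist_triangle_left y z x
    linarith
  obtain ⟨x', y', z', p', q', h1, h2, h3, h4, h5, h6, h7, h8⟩ :=
    UpperHalfPlane.exists_isosceles hr hrR hR dist_nonneg hD
  rw [← h8]
  refine sinh_le_sinh.2 (div_le_div_of_nonneg_right ?_ two_pos.le)
  refine hY x y z p q (by linarith) (by linarith) x' y' z' p' q' ?_ ?_ ?_ ?_ ?_ ?_ ?_ <;> linarith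

theorem TrianglesThinnerThan.dist_le (hY : TrianglesThinnerThan UpperHalfPlane Y)
    {x y z p q : Y} {r R : ℝ} (hxy : dist x y = R) (hxz : dist x z = R)
    (hxp : dist x p = r) (hpy : dist p y = R - r) (hxq : dist x q = r) (hqz : dist q z = R - r) :
    dist p q ≤ dist y z := by
  have hr : 0 ≤ r := hxp ▸ dist_nonneg
  have hrR : r ≤ R := sub_nonneg.1 (hpy ▸ dist_nonneg)
  rcases (hr.trans hrR).eq_or_lt with hR | hR
  · have hr0 : r = 0 := by linarith
    have e1 : x = p := dist_eq_zero.1 (by linarith)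
    have e2 : x = q := dist_eq_zero.1 (by linarith)
    rw [← e1, ← e2, dist_self]
    exact dist_nonneg
  · have h1 := hY.sinh_half_dist_le hR hxy hxz hxp hpy hxq hqz
    have h2 : sinh r / sinh R ≤ 1 := (div_le_one (sinh_pos_iff.2 hR)).2 (sinh_le_sinh.2 hrR)
    have h3 : 0 ≤ sinh (dist y z / 2) := sinh_nonneg_iff.2 (by positivity)
    have := sinh_le_sinh.1 (h1.trans (mul_le_of_le_one_left h3 h2))
    linarith

end Contraction

/-! ### Coverings and maps with small fibre components -/

section Covering

theorem HasClosedRefinements.mono {K : Type u} [TopologicalSpace K] {m n : ℕ}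
    (h : HasClosedRefinements K m) (hmn : m ≤ n) : HasClosedRefinements K n := by
  intro 𝒰 ho hc
  obtain ⟨𝒞, h1, h2, h3, h4, h5⟩ := h 𝒰 ho hc
  exact ⟨𝒞, h1, h2, h3, h4, fun x => (h5 x).trans (by exact_mod_cast hmn)⟩

/-- A compact set whose connected subsets are subordinate to an open covering is contained in a
finite disjoint union of open sets subordinate to that covering. -/
theorem exists_disjoint_open_cover {K : Type u} [TopologicalSpace K] [CompactSpace K] [T2Space K]
    {𝒰 : Set (Set K)} (ho : ∀ U ∈ 𝒰, IsOpen U) {F : Set K} (hF : IsClosed F)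
    (h : ∀ x ∈ F, ∃ U ∈ 𝒰, connectedComponentIn F x ⊆ U) :
    ∃ (k : ℕ) (W : Fin k → Set K), (∀ i, IsOpen (W i)) ∧ (∀ i, ∃ U ∈ 𝒰, W i ⊆ U) ∧
      (∀ i j x, x ∈ W i → x ∈ W j → i = j) ∧ F ⊆ ⋃ i, W i := by
  classical
  have : CompactSpace F := isCompact_iff_compactSpace.1 hF.isCompact
  have hQ : ∀ x : F, ∃ Q : Set F, IsClopen Q ∧ x ∈ Q ∧ ∃ U ∈ 𝒰, Q ⊆ Subtype.val ⁻¹' U := by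
    intro x
    obtain ⟨U, hU, hxU⟩ := h x x.2
    -- In a compact Hausdorff space a component is the intersection of the clopen sets around it, so
    -- by compactness one of these already lies in `U`.
    have h1 : (⋂ s : { s : Set F // IsClopen s ∧ x ∈ s }, s.1) ⊆ Subtype.val ⁻¹' U := by
      rw [← connectedComponent_eq_iInter_isClopen x, ← Set.image_subset_iff,
        ← connectedComponentIn_eq_image x.2]
      exact hxU
    have : Nonempty { s : Set F // IsClopen s ∧ x ∈ s } := ⟨⟨Set.univ, isClopen_univ, trivial⟩⟩
    obtain ⟨⟨Q, hQ1, hQ2⟩, hQ⟩ := exists_subset_nhds_of_compactSpace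
      (V := fun s : { s : Set F // IsClopen s ∧ x ∈ s } => s.1)
      (fun a b => ⟨⟨a.1 ∩ b.1, a.2.1.inter b.2.1, a.2.2, b.2.2⟩, Set.inter_subset_left,
        Set.inter_subset_right⟩) (fun a => a.2.1.1)
      (fun y hy => ((ho U hU).preimage continuous_subtype_val).mem_nhds (h1 hy))
    exact ⟨Q, hQ1, hQ2, U, hU, hQ⟩
  choose Q hQc hQm U hU hQU using hQ
  obtain ⟨s, hs⟩ := isCompact_univ.elim_finite_subcover Q (fun x => (hQc x).2)
    (fun x _ => Set.mem_iUnion.2 ⟨x, hQm x⟩)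
  let e := s.equivFin
  set k := s.card
  let P : Fin k → Set F := fun i => Q (e.symm i)
  -- The index of the first clopen set containing `x` turns the finite clopen cover into a
  -- partition.
  let φ : F → ℕ := fun x => sInf {i : ℕ | ∃ hi : i < k, x ∈ P ⟨i, hi⟩}
  have hφ : ∀ x, ∃ hi : φ x < k, x ∈ P ⟨φ x, hi⟩ := by
    intro x
    have : {i : ℕ | ∃ hi : i < k, x ∈ P ⟨i, hi⟩}.Nonempty := by
      obtain ⟨y, hy⟩ := Set.mem_iUnion.1 (hs (Set.mem_univ x))
      obtain ⟨hys, hy⟩ := Set.mem_iUnion.1 hy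
      refine ⟨e ⟨y, hys⟩, (e ⟨y, hys⟩).2, ?_⟩
      simpa [P] using hy
    exact Nat.sInf_mem this
  have hφc : IsLocallyConstant φ := by
    rw [IsLocallyConstant.iff_eventually_eq]
    intro x
    have h1 : ∀ i : Fin k, ∀ᶠ y in nhds x, (y ∈ P i ↔ x ∈ P i) := by
      intro i
      by_cases hx : x ∈ P i
      · filter_upwards [(hQc _).2.mem_nhds hx] with y hy
        exact ⟨fun _ => hx, fun _ => hy⟩
      · filter_upwards [(hQc _).1.isOpen_compl.mem_nhds hx] with y hy
        exact ⟨fun h => absurd h hy, fun h => absurd h hx⟩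
    filter_upwards [Filter.eventually_all.2 h1] with y hy
    simp only [φ, hy]
  -- Tietze extends the index to a real function on `K`; preimages of the balls of radius `1 / 2`
  -- about integers are open and disjoint.
  obtain ⟨Φ, hΦ⟩ := ContinuousMap.exists_restrict_eq hF
    (⟨fun x => (φ x : ℝ), (continuous_of_discreteTopology (f := fun n : ℕ => (n : ℝ))).comp
      hφc.continuous⟩ : C(F, ℝ))
  have hΦ' : ∀ x : F, Φ x = φ x := fun x => DFunLike.congr_fun hΦ x
  refine ⟨k, fun i => Φ ⁻¹' Metric.ball (i : ℝ) (1 / 2) ∩ U (e.symm i), fun i => ?_, fun i => ?_,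
    fun i j x hi hj => ?_, fun x hx => ?_⟩
  · exact (Metric.isOpen_ball.preimage Φ.continuous).inter (ho _ (hU _))
  · exact ⟨_, hU _, Set.inter_subset_right⟩
  · have h1 := Metric.mem_ball.1 hi.1
    have h2 := Metric.mem_ball.1 hj.1
    have h3 := dist_triangle_left (i : ℝ) j (Φ x)
    have h4 : dist ((i : ℕ) : ℤ) ((j : ℕ) : ℤ) < 1 := by
      rw [Int.dist_eq]
      rw [Real.dist_eq] at h3
      push_cast
      linarith
    rw [Int.dist_eq] at h4
    have h5 : |((i : ℕ) : ℤ) - ((j : ℕ) : ℤ)| < 1 := by exact_mod_cast h4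
    rw [Int.abs_lt_one_iff] at h5
    exact Fin.ext (by omega)
  · obtain ⟨hi, hx'⟩ := hφ ⟨x, hx⟩
    refine Set.mem_iUnion.2 ⟨⟨_, hi⟩, ?_, hQU _ hx'⟩
    simp [hΦ' ⟨x, hx⟩]

/-- A form of Hurewicz' theorem on dimension-lowering maps: if `𝒰` has no closed refinement of
multiplicity `m`, then every map to a space with such refinements has a fibre with a component
that is not subordinate to `𝒰`. -/
theorem HasClosedRefinements.exists_refinement {K : Type u} {L : Type v} [TopologicalSpace K]
    [CompactSpace K] [T2Space K] [TopologicalSpace L] [T2Space L] {m : ℕ}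
    (hL : HasClosedRefinements L m) {h : K → L} (hh : Continuous h) {𝒰 : Set (Set K)}
    (ho : ∀ U ∈ 𝒰, IsOpen U)
    (hsmall : ∀ x, ∃ U ∈ 𝒰, connectedComponentIn (h ⁻¹' {h x}) x ⊆ U) :
    ∃ 𝒞 : Set (Set K), 𝒞.Finite ∧ (∀ C ∈ 𝒞, IsClosed C) ∧ ⋃₀ 𝒞 = Set.univ ∧
      (∀ C ∈ 𝒞, ∃ U ∈ 𝒰, C ⊆ U) ∧ ∀ x : K, {C ∈ 𝒞 | x ∈ C}.encard ≤ m := by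
  rcases isEmpty_or_nonempty L with hLe | hLe
  · have : IsEmpty K := Function.isEmpty h
    exact ⟨∅, Set.finite_empty, by simp, Subsingleton.elim _ _, by simp, isEmptyElim⟩
  have h1 : ∀ t : L, ∃ (k : ℕ) (W : Fin k → Set K), (∀ i, IsOpen (W i)) ∧
      (∀ i, ∃ U ∈ 𝒰, W i ⊆ U) ∧ (∀ i j x, x ∈ W i → x ∈ W j → i = j) ∧
      h ⁻¹' {t} ⊆ ⋃ i, W i := fun t =>
    exists_disjoint_open_cover ho (isClosed_singleton.preimage hh) (fun x hx => by
      obtain rfl : h x = t := hx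
      exact hsmall x)
  choose k W hWo hWU hWd hW using h1
  -- The points whose whole fibre lies in the disjoint union chosen for `t`; open because `h` is a
  -- closed map.
  let V : L → Set L := fun t => (h '' (⋃ i, W t i)ᶜ)ᶜ
  have hVo : ∀ t, IsOpen (V t) := fun t =>
    (((isOpen_iUnion (hWo t)).isClosed_compl.isCompact.image hh).isClosed).isOpen_compl
  have hV : ∀ t x, h x ∈ V t → x ∈ ⋃ i, W t i := fun t x hx => by
    by_contra hx'
    exact hx ⟨x, hx', rfl⟩
  have htV : ∀ t, t ∈ V t := by
    rintro t ⟨x, hx, rfl⟩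
    exact hx (hW _ rfl)
  obtain ⟨𝒞, hfin, hcl, hcov, href, hmult⟩ := hL (Set.range V)
    (by rintro _ ⟨t, rfl⟩; exact hVo t)
    (Set.eq_univ_of_forall fun t => ⟨V t, ⟨t, rfl⟩, htV t⟩)
  have href' : ∀ C : Set L, ∃ t, C ∈ 𝒞 → C ⊆ V t := by
    intro C
    by_cases hC : C ∈ 𝒞
    · obtain ⟨_, ⟨t, rfl⟩, ht⟩ := href C hC
      exact ⟨t, fun _ => ht⟩
    · exact ⟨Classical.arbitrary L, fun h => absurd h hC⟩
  choose τ hτ using href'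
  refine ⟨⋃ C ∈ 𝒞, Set.range fun i => h ⁻¹' C ∩ W (τ C) i,
    hfin.biUnion fun C _ => Set.finite_range _, ?_, ?_, ?_, ?_⟩
  · intro D hD
    obtain ⟨C, hC, i, rfl⟩ := by simpa using hD
    -- Over `C` the sets `W (τ C) j` form a partition, so each piece is what remains after removing
    -- the other open ones, hence closed.
    have : h ⁻¹' C ∩ W (τ C) i = h ⁻¹' C ∩ (⋃ (j) (_ : j ≠ i), W (τ C) j)ᶜ := by
      ext x
      refine and_congr_right fun hx => ⟨fun hi hj => ?_, fun hx' => ?_⟩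
      · obtain ⟨j, hji, hj⟩ := by simpa using hj
        exact hji (hWd _ _ _ x hj hi)
      · obtain ⟨j, hj⟩ := Set.mem_iUnion.1 (hV _ x (hτ C hC hx))
        by_cases hji : j = i
        · exact hji ▸ hj
        · exact absurd (Set.mem_iUnion₂.2 ⟨j, hji, hj⟩) hx'
    rw [this]
    exact ((hcl C hC).preimage hh).inter
      (isOpen_biUnion fun j _ => hWo _ j).isClosed_compl
  · refine Set.eq_univ_of_forall fun x => ?_
    obtain ⟨C, hC, hx⟩ := Set.mem_sUnion.1 (hcov ▸ Set.mem_univ (h x))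
    obtain ⟨i, hi⟩ := Set.mem_iUnion.1 (hV _ x (hτ C hC hx))
    exact ⟨_, Set.mem_iUnion₂.2 ⟨C, hC, i, rfl⟩, hx, hi⟩
  · intro D hD
    obtain ⟨C, hC, i, rfl⟩ := by simpa using hD
    obtain ⟨U, hU, hWU⟩ := hWU (τ C) i
    exact ⟨U, hU, Set.inter_subset_right.trans hWU⟩
  · intro x
    refine le_trans ?_ (hmult (h x))
    -- By disjointness each `C` contributes at most one piece through `x`, so pulling back does not
    -- raise the multiplicity.
    refine le_trans (Set.encard_le_encard ?_) (Set.encard_image_le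
      (fun C => {y | h y ∈ C ∧ ∃ i, x ∈ W (τ C) i ∧ y ∈ W (τ C) i}) _)
    rintro D ⟨hD, hxD⟩
    obtain ⟨C, hC, i, rfl⟩ := by simpa using hD
    refine ⟨C, ⟨hC, hxD.1⟩, ?_⟩
    ext y
    constructor
    · rintro ⟨hy, j, hxj, hyj⟩
      exact ⟨hy, hWd _ _ _ x hxj hxD.2 ▸ hyj⟩
    · rintro ⟨hy, hyi⟩
      exact ⟨hy, i, hxD.2, hyi⟩

end Covering

/-! ### Geodesic rays in CAT(-1) spaces -/

section Rays

open Real Filter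

variable {Y : Type u} [MetricSpace Y]

/-- `c` restricts to a unit speed geodesic on `[0, R]`. -/
def IsGeodesicOn (c : ℝ → Y) (R : ℝ) : Prop :=
  ∀ s ∈ Set.Icc 0 R, ∀ t ∈ Set.Icc 0 R, dist (c s) (c t) = |s - t|

theorem IsGeodesicOn.dist_eq {c : ℝ → Y} {R : ℝ} (hc : IsGeodesicOn c R) {s t : ℝ} (hs : 0 ≤ s)
    (hst : s ≤ t) (htR : t ≤ R) : dist (c s) (c t) = t - s := by
  rw [hc s ⟨hs, hst.trans htR⟩ t ⟨hs.trans hst, htR⟩, abs_sub_comm, abs_of_nonneg (by linarith)]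

theorem IsGeodesicOn.mono {c : ℝ → Y} {R R' : ℝ} (hc : IsGeodesicOn c R) (h : R' ≤ R) :
    IsGeodesicOn c R' := fun s hs t ht => hc s ⟨hs.1, hs.2.trans h⟩ t ⟨ht.1, ht.2.trans h⟩

theorem Isometry.isGeodesicOn {c : ℝ≥0 → Y} (hc : Isometry c) (R : ℝ) :
    IsGeodesicOn (fun t => c t.toNNReal) R := fun s hs t ht => by
  change dist (c s.toNNReal) (c t.toNNReal) = _
  rw [hc.dist_eq, NNReal.dist_eq, coe_toNNReal s hs.1, coe_toNNReal t ht.1]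

theorem TrianglesThinnerThan.sinh_half_dist_geodesic_le
    (hY : TrianglesThinnerThan UpperHalfPlane Y) {c c' : ℝ → Y} {t s : ℝ}
    (hc : IsGeodesicOn c t) (hc' : IsGeodesicOn c' t) (h0 : c 0 = c' 0) (hs : 0 ≤ s)
    (hst : s ≤ t) (ht : 0 < t) :
    sinh (dist (c s) (c' s) / 2) ≤ sinh s / sinh t * sinh (dist (c t) (c' t) / 2) := by
  refine hY.sinh_half_dist_le (x := c 0) ht ?_ ?_ ?_ (hc.dist_eq hs hst le_rfl) ?_
    (hc'.dist_eq hs hst le_rfl)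
  · rw [hc.dist_eq le_rfl ht.le le_rfl, sub_zero]
  · rw [h0, hc'.dist_eq le_rfl ht.le le_rfl, sub_zero]
  · rw [hc.dist_eq le_rfl hs hst, sub_zero]
  · rw [h0, hc'.dist_eq le_rfl hs hst, sub_zero]

theorem tendsto_sinh_atTop : Tendsto sinh atTop atTop :=
  tendsto_atTop_mono' _ ((eventually_ge_atTop 0).mono fun _ h => self_le_sinh_iff.2 h) tendsto_id

/-- Geodesics issuing from a common point that are `D`-close at a large time are `ε`-close at
time `s`. -/
theorem TrianglesThinnerThan.eventually_dist_lt (hY : TrianglesThinnerThan UpperHalfPlane Y)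
    {s : ℝ} (hs : 0 ≤ s) (D : ℝ) {ε : ℝ} (hε : 0 < ε) :
    ∀ᶠ t in atTop, ∀ c c' : ℝ → Y, IsGeodesicOn c t → IsGeodesicOn c' t → c 0 = c' 0 →
      dist (c t) (c' t) ≤ D → dist (c s) (c' s) < ε := by
  have h1 : Tendsto (fun t => sinh s * sinh (D / 2) / sinh t) atTop (nhds 0) :=
    tendsto_sinh_atTop.const_div_atTop _
  filter_upwards [h1.eventually_lt_const (half_pos hε), eventually_gt_atTop 0,
    eventually_ge_atTop s] with t ht ht0 hst c c' hc hc' h0 hD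
  have h2 := hY.sinh_half_dist_geodesic_le hc hc' h0 hs hst ht0
  have h3 : sinh s / sinh t * sinh (dist (c t) (c' t) / 2) ≤ sinh s / sinh t * sinh (D / 2) :=
    mul_le_mul_of_nonneg_left (sinh_le_sinh.2 (by linarith))
      (div_nonneg (sinh_nonneg_iff.2 hs) (sinh_nonneg_iff.2 ht0.le))
  have h4 : dist (c s) (c' s) / 2 ≤ sinh (dist (c s) (c' s) / 2) :=
    self_le_sinh_iff.2 (by positivity)
  have h5 : sinh s / sinh t * sinh (D / 2) = sinh s * sinh (D / 2) / sinh t := by ring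
  linarith

/-- Measured from the common end, points at equal distance are compared by `dist_le`. The lengths
differ by at most `dist (σ 0) (c 0)`; this shift is paid once at each end, whence the factor `3`. -/
theorem TrianglesThinnerThan.dist_geodesic_le_of_same_end
    (hY : TrianglesThinnerThan UpperHalfPlane Y) {c σ : ℝ → Y} {n R t : ℝ}
    (hc : IsGeodesicOn c n) (hσ : IsGeodesicOn σ R) (hend : σ R = c n) (ht : 0 ≤ t)
    (htn : t ≤ n) (htR : t ≤ R) : dist (σ t) (c t) ≤ 3 * dist (σ 0) (c 0) := by
  wlog h : n ≤ R generalizing c σ n R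
  · have := this hσ hc hend.symm htR htn (le_of_not_ge h)
    rwa [dist_comm, dist_comm (c 0)] at this
  have hRn : R - n ≤ dist (σ 0) (c 0) := by
    have h1 := hσ.dist_eq le_rfl (ht.trans htR) le_rfl
    have h2 := hc.dist_eq le_rfl (ht.trans htn) le_rfl
    have h3 := dist_triangle (σ 0) (c 0) (c n)
    rw [← hend] at h3 h2
    linarith
  have key : dist (σ (R - n + t)) (c t) ≤ dist (σ (R - n)) (c 0) := by
    refine hY.dist_le (x := c n) (R := n) (r := n - t) ?_ ?_ ?_ ?_ ?_ ?_
    · rw [← hend, dist_comm, hσ.dist_eq (by linarith) (by linarith) le_rfl]; ring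
    · rw [dist_comm, hc.dist_eq le_rfl (by linarith) le_rfl]; ring
    · rw [← hend, dist_comm, hσ.dist_eq (by linarith) (by linarith) le_rfl]; ring
    · rw [dist_comm, hσ.dist_eq (by linarith) (by linarith) (by linarith)]; ring
    · rw [dist_comm, hc.dist_eq ht htn le_rfl]
    · rw [dist_comm, hc.dist_eq le_rfl ht htn]; ring
  have h1 := hσ.dist_eq ht (show t ≤ R - n + t by linarith) (by linarith)
  have h2 := hσ.dist_eq le_rfl (show 0 ≤ R - n by linarith) (by linarith)
  have h3 := dist_triangle (σ t) (σ (R - n + t)) (c t)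
  have h4 := dist_triangle (σ (R - n)) (σ 0) (c 0)
  rw [dist_comm (σ (R - n)) (σ 0)] at h4
  linarith

/-- Two asymptotic rays issuing from the same point coincide. -/
theorem TrianglesThinnerThan.ray_eq (hY : TrianglesThinnerThan UpperHalfPlane Y)
    {c c' : GeodesicRay Y} (h : (asymptoticSetoid Y).r c c') (h0 : c.1 0 = c'.1 0) : c = c' := by
  obtain ⟨C, hC⟩ := h
  refine Subtype.ext (funext fun s => dist_le_zero.1 (le_of_forall_pos_lt_add fun ε hε => ?_))
  obtain ⟨t, ht⟩ := (hY.eventually_dist_lt s.2 C hε).exists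
  simpa using ht _ _ (c.2.isGeodesicOn t) (c'.2.isGeodesicOn t) (by simpa using h0) (hC _)

/-- Every ray is asymptotic to a ray issuing from a given point. -/
theorem TrianglesThinnerThan.exists_asymptotic_ray [CompleteSpace Y] (hg : IsGeodesicSpace Y)
    (hY : TrianglesThinnerThan UpperHalfPlane Y) (c : GeodesicRay Y) (z : Y) :
    ∃ c' : GeodesicRay Y, c'.1 0 = z ∧ ∀ t, dist (c'.1 t) (c.1 t) ≤ 3 * dist z (c.1 0) := by
  set L := dist z (c.1 0) with hL
  choose σ hσ0 hσ1 hσ using fun n : ℕ => hg z (c.1 n)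
  have hR : ∀ n : ℕ, (n : ℝ) - L ≤ dist z (c.1 n) := by
    intro n
    have h1 : dist (c.1 0) (c.1 n) = n := by
      rw [c.2.dist_eq, NNReal.dist_eq]
      simp
    have := dist_triangle_left (c.1 0) (c.1 n) z
    linarith
  have hσg : ∀ n : ℕ, ∀ t : ℝ, t + L ≤ n → IsGeodesicOn (σ n) t := fun n t ht =>
    IsGeodesicOn.mono (R := dist z (c.1 n)) (hσ n) (by linarith [hR n])
  have hL0 : 0 ≤ L := dist_nonneg
  have hnear : ∀ n : ℕ, ∀ t : ℝ≥0, t + L ≤ n → dist (σ n t) (c.1 t) ≤ 3 * L := by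
    intro n t ht
    have := hY.dist_geodesic_le_of_same_end (c.2.isGeodesicOn n) (hσ n) (t := t)
      (by simpa using hσ1 n) t.2 (by linarith) (by linarith [hR n])
    simpa [hσ0 n] using this
  have hev : ∀ t : ℝ≥0, ∀ᶠ n : ℕ in atTop, (t : ℝ) + L ≤ n := fun t =>
    tendsto_natCast_atTop_atTop.eventually_ge_atTop _
  have hcau : ∀ s : ℝ≥0, CauchySeq fun n => σ n s := by
    intro s
    refine Metric.cauchySeq_iff.2 fun ε hε => ?_
    -- At a late time `t` the segments to `c n` are within `3 * L` of `c t`, hence `6 * L` from each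
    -- other; contraction makes them `ε`-close at time `s`.
    obtain ⟨t, ht, ht0⟩ := ((hY.eventually_dist_lt s.2 (6 * L) hε).and
      (eventually_ge_atTop 0)).exists
    lift t to ℝ≥0 using ht0
    obtain ⟨N, hN⟩ := eventually_atTop.1 (hev t)
    refine ⟨N, fun m hm n hn => ht _ _ (hσg m t (hN m hm)) (hσg n t (hN n hn))
      ((hσ0 m).trans (hσ0 n).symm) ?_⟩
    have h1 := hnear m t (hN m hm)
    have h2 := hnear n t (hN n hn)
    have h3 := dist_triangle_right (σ m t) (σ n t) (c.1 t)
    linarith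
  choose c' hc' using fun s => cauchySeq_tendsto_of_complete (hcau s)
  refine ⟨⟨c', Isometry.of_dist_eq fun s t => ?_⟩, ?_, fun t => ?_⟩
  · refine tendsto_nhds_unique ((hc' s).dist (hc' t)) (tendsto_const_nhds.congr' ?_)
    filter_upwards [hev (max s t)] with n hn
    rw [NNReal.dist_eq, hσg n _ hn s ⟨s.2, by simp⟩ t ⟨t.2, by simp⟩]
  · refine tendsto_nhds_unique (hc' 0) (tendsto_const_nhds.congr fun n => ?_)
    simpa using (hσ0 n).symm
  · exact le_of_tendsto ((hc' t).dist tendsto_const_nhds) ((hev t).mono fun n hn => hnear n t hn)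

/-- By uniqueness `c'` is the ray built in `exists_asymptotic_ray`, so the bound depends only on the
starting points and is uniform over the boundary. -/
theorem TrianglesThinnerThan.dist_asymptotic_le [CompleteSpace Y] (hg : IsGeodesicSpace Y)
    (hY : TrianglesThinnerThan UpperHalfPlane Y) {c c' : GeodesicRay Y}
    (h : (asymptoticSetoid Y).r c' c) (t : ℝ≥0) :
    dist (c'.1 t) (c.1 t) ≤ 3 * dist (c'.1 0) (c.1 0) := by
  obtain ⟨d, hd0, hd⟩ := hY.exists_asymptotic_ray hg c (c'.1 0)
  obtain rfl : d = c' := hY.ray_eq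
    ((asymptoticSetoid Y).iseqv.trans ⟨_, hd⟩ ((asymptoticSetoid Y).iseqv.symm h)) hd0
  exact hd t

/-- The points at time `t` of the rays from `y₀` to the points at infinity. -/
theorem TrianglesThinnerThan.exists_radial_map [CompleteSpace Y] (hg : IsGeodesicSpace Y)
    (hY : TrianglesThinnerThan UpperHalfPlane Y) (y₀ : Y) :
    ∃ pr : BoundaryAtInfinity Y → ℝ≥0 → Y,
      (∀ ξ t, dist (pr ξ t) y₀ = t) ∧
      (∀ t, Continuous fun ξ => pr ξ t) ∧
      Function.Injective pr ∧
      (∀ ξ η s t, s ≤ t → 0 < t → sinh (dist (pr ξ s) (pr η s) / 2) ≤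
        sinh s / sinh t * sinh (dist (pr ξ t) (pr η t) / 2)) ∧
      (∀ ξ η s t, s ≤ t → dist (pr ξ s) (pr η s) ≤ dist (pr ξ t) (pr η t)) ∧
      ∀ U : Set (BoundaryAtInfinity Y), IsOpen U → ∀ ξ ∈ U, ∃ t, ∀ η,
        dist (pr η t) (pr ξ t) < 2 → η ∈ U := by
  have hex : ∀ (z : Y) (ξ : BoundaryAtInfinity Y), ∃ c : GeodesicRay Y,
      c.1 0 = z ∧ Quotient.mk (asymptoticSetoid Y) c = ξ := by
    intro z ξ
    obtain ⟨c, rfl⟩ := Quotient.exists_rep ξ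
    obtain ⟨c', h0, h⟩ := hY.exists_asymptotic_ray hg c z
    exact ⟨c', h0, Quotient.sound ⟨_, h⟩⟩
  choose ray hray0 hray using hex
  have huniq : ∀ (z : Y) (c : GeodesicRay Y), c.1 0 = z →
      ray z (Quotient.mk (asymptoticSetoid Y) c) = c := fun z c hz =>
    hY.ray_eq (Quotient.exact (hray z _)) ((hray0 z _).trans hz.symm)
  have hcone : ∀ (c : GeodesicRay Y) (r : ℝ≥0) (ε : ℝ) (ξ), ξ ∈ coneNhd c r ε ↔
      dist ((ray (c.1 0) ξ).1 r) (c.1 r) < ε := by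
    refine fun c r ε ξ => ⟨?_, fun h => ⟨ray (c.1 0) ξ, hray0 _ _, hray _ _, h⟩⟩
    rintro ⟨c', h0, rfl, h⟩
    rwa [huniq _ _ h0]
  have hcontr : ∀ ξ η (s t : ℝ≥0), s ≤ t → 0 < t →
      sinh (dist ((ray y₀ ξ).1 s) ((ray y₀ η).1 s) / 2) ≤
        sinh s / sinh t * sinh (dist ((ray y₀ ξ).1 t) ((ray y₀ η).1 t) / 2) := by
    intro ξ η s t hst ht
    simpa using hY.sinh_half_dist_geodesic_le ((ray y₀ ξ).2.isGeodesicOn t)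
      ((ray y₀ η).2.isGeodesicOn t) (by simp [hray0]) s.2 hst ht
  have hmono : ∀ ξ η (s t : ℝ≥0), s ≤ t →
      dist ((ray y₀ ξ).1 s) ((ray y₀ η).1 s) ≤ dist ((ray y₀ ξ).1 t) ((ray y₀ η).1 t) := by
    intro ξ η s t hst
    rcases eq_zero_or_pos t with rfl | ht
    · rw [nonpos_iff_eq_zero.1 hst]
    · have h1 := hcontr ξ η s t hst ht
      have h2 : sinh (s : ℝ) / sinh t ≤ 1 :=
        (div_le_one (sinh_pos_iff.2 (by exact_mod_cast ht))).2 (sinh_le_sinh.2 hst)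
      have h3 := sinh_le_sinh.1
        (h1.trans (mul_le_of_le_one_left (sinh_nonneg_iff.2 (by positivity)) h2))
      linarith
  refine ⟨fun ξ t => (ray y₀ ξ).1 t, fun ξ t => ?_, fun t => ?_, fun ξ η h => ?_, hcontr, hmono, ?_⟩
  · have h : dist ((ray y₀ ξ).1 t) ((ray y₀ ξ).1 0) = t := by
      rw [(ray y₀ ξ).2.dist_eq, NNReal.dist_eq]
      simp
    rwa [hray0] at h
  · refine Metric.continuous_iff'.2 fun ξ ε hε => ?_
    have hξ : ξ ∈ coneNhd (ray y₀ ξ) t ε := by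
      rw [hcone, hray0, dist_self]
      exact hε
    filter_upwards [(TopologicalSpace.isOpen_generateFrom_of_mem
      ⟨ray y₀ ξ, t, ε, hε, rfl⟩ : IsOpen (coneNhd (ray y₀ ξ) t ε)).mem_nhds hξ] with η hη
    rwa [hcone, hray0] at hη
  · rw [← hray y₀ ξ, ← hray y₀ η, Subtype.ext h]
  · intro U hU
    induction hU with
    | basic U hU =>
      obtain ⟨c, r, ε, -, rfl⟩ := hU
      intro ξ hξ
      rw [hcone] at hξ
      -- Cone neighbourhoods may be based at any `z`. Passing from `y₀` to `z` costs `3 * dist z y₀`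
      -- for each of the two rays, on top of the given `2`.
      set z := c.1 0
      obtain ⟨t, ht, ht0⟩ := ((hY.eventually_dist_lt r.2 (2 + 6 * dist z y₀)
        (sub_pos.2 hξ)).and (eventually_ge_atTop 0)).exists
      lift t to ℝ≥0 using ht0
      refine ⟨t, fun η (hη : dist ((ray y₀ η).1 t) ((ray y₀ ξ).1 t) < 2) => ?_⟩
      rw [hcone]
      have hasy : ∀ ζ, dist ((ray z ζ).1 t) ((ray y₀ ζ).1 t) ≤ 3 * dist z y₀ := by
        intro ζ
        have := hY.dist_asymptotic_le hg
          (Quotient.exact ((hray z ζ).trans (hray y₀ ζ).symm)) t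
        rwa [hray0, hray0] at this
      have h1 := ht _ _ ((ray z η).2.isGeodesicOn t) ((ray z ξ).2.isGeodesicOn t)
        (by simp [hray0]) (by
          rw [Real.toNNReal_coe]
          have h2 := dist_triangle4 ((ray z η).1 t) ((ray y₀ η).1 t)
            ((ray y₀ ξ).1 t) ((ray z ξ).1 t)
          have h3 := hasy η
          have h4 := hasy ξ
          rw [dist_comm] at h4
          linarith)
      have h2 : dist ((ray z η).1 r) ((ray z ξ).1 r) < ε - dist ((ray z ξ).1 r) (c.1 r) := by
        simpa using h1
      have h3 := dist_triangle ((ray z η).1 r) ((ray z ξ).1 r) (c.1 r)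
      linarith
    | univ => exact fun _ _ => ⟨0, fun _ _ => trivial⟩
    | inter U V _ _ hU hV =>
      intro ξ hξ
      obtain ⟨t, ht⟩ := hU ξ hξ.1
      obtain ⟨t', ht'⟩ := hV ξ hξ.2
      exact ⟨max t t', fun η hη => ⟨ht η ((hmono _ _ _ _ (le_max_left _ _)).trans_lt hη),
        ht' η ((hmono _ _ _ _ (le_max_right _ _)).trans_lt hη)⟩⟩
    | sUnion 𝒮 _ ih =>
      rintro ξ ⟨U, hU, hξ⟩
      obtain ⟨t, ht⟩ := ih U hU ξ hξ
      exact ⟨t, fun η hη => ⟨U, hU, ht η hη⟩⟩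

end Rays

/-! ### Separated nets -/

section Nets

theorem exists_isMaximalSeparatedNet (X : Type u) [MetricSpace X] (δ : ℝ) :
    ∃ N : Set X, IsMaximalSeparatedNet δ N := by
  refine zorn_subset {A : Set X | A.Pairwise fun a a' => δ ≤ dist a a'} fun c hc hchain =>
    ⟨⋃₀ c, (Set.pairwise_sUnion hchain.directedOn).2 hc, fun s hs => Set.subset_sUnion_of_mem hs⟩

theorem IsMaximalSeparatedNet.exists_dist_lt {X : Type u} [MetricSpace X] {δ : ℝ} {N : Set X}
    (hN : IsMaximalSeparatedNet δ N) (hδ : 0 < δ) (x : X) : ∃ a ∈ N, dist x a < δ := by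
  by_contra! h
  have hx : x ∈ N := hN.le_of_ge (y := insert x N)
    (hN.prop.insert fun a ha _ => ⟨h a ha, by rw [dist_comm]; exact h a ha⟩)
    (Set.subset_insert x N) (Set.mem_insert x N)
  exact absurd (h x hx) (by rwa [dist_self, not_le])

/-- A connected set is not shorter than the sum of the diameters of the members of a covering. -/
theorem IsPreconnected.ofReal_dist_div_le_encard {α ι : Type*} [TopologicalSpace α]
    {Y : Type*} [PseudoMetricSpace Y] {F : Set α} (hF : IsPreconnected F) {p : α → Y}
    (hp : Continuous p) {S : Set ι} {V : ι → Set α} (hV : ∀ x ∈ F, ∃ i ∈ S, x ∈ V i) {w : ℝ}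
    (hw : 0 < w) (hVw : ∀ i ∈ S, ∀ x ∈ V i, ∀ y ∈ V i, dist (p x) (p y) ≤ w) {x y : α}
    (hx : x ∈ F) (hy : y ∈ F) :
    ENNReal.ofReal (dist (p x) (p y) / w) ≤ (S.encard : ℝ≥0∞) := by
  rcases S.finite_or_infinite with hS | hS
  swap
  · simp [hS.encard_eq]
  set φ : α → ℝ := fun z => dist (p x) (p z)
  have hφ : Continuous φ := continuous_const.dist hp
  have h1 : Set.Icc 0 (dist (p x) (p y)) ⊆ ⋃ i ∈ hS.toFinset, φ '' V i := by
    intro s hs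
    obtain ⟨z, hz, rfl⟩ := hF.intermediate_value hx hy hφ.continuousOn
      (show s ∈ Set.Icc (φ x) (φ y) by simpa [φ] using hs)
    obtain ⟨i, hi, hzi⟩ := hV z hz
    exact Set.mem_iUnion₂.2 ⟨i, hS.mem_toFinset.2 hi, z, hzi, rfl⟩
  have h2 : ∀ i ∈ hS.toFinset, MeasureTheory.volume (φ '' V i) ≤ ENNReal.ofReal w := by
    intro i hi
    refine (Real.volume_le_diam _).trans (Metric.ediam_le ?_)
    rintro _ ⟨a, ha, rfl⟩ _ ⟨b, hb, rfl⟩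
    rw [edist_dist]
    refine ENNReal.ofReal_le_ofReal ((dist_dist_dist_le_right _ _ _).trans ?_)
    exact hVw i (hS.mem_toFinset.1 hi) a ha b hb
  have h3 := (MeasureTheory.measure_mono h1).trans
    ((MeasureTheory.measure_biUnion_finset_le (μ := MeasureTheory.volume) _ _).trans
      (Finset.sum_le_card_nsmul _ _ _ h2))
  rw [Real.volume_Icc, sub_zero, nsmul_eq_mul] at h3
  rw [hS.encard_eq_coe_toFinset_card, ENNReal.ofReal_div_of_pos hw]
  exact ENNReal.div_le_of_le_mul (by simpa using h3)

end Nets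

/-! ### Subexponential partitions and hyperbolic spaces -/

section Main

open Real Filter

/-- The left side has slope `1 / 2` in `R`, while `log (sinh R)` has asymptotic slope `1`. -/
theorem eventually_le_log_mul_sinh {a κ : ℝ} (b : ℝ) (ha : 0 < a) (hκ : 0 < κ) :
    ∀ᶠ R in atTop, (a * R + b) * (1 / (2 * a)) ≤ log (κ * sinh R) := by
  filter_upwards [eventually_ge_atTop 1,
    eventually_ge_atTop (2 * (b * (1 / (2 * a)) - log (κ / 4)))] with R h1 h2
  have h3 : exp R / 4 ≤ sinh R := by
    have h4 := add_one_le_exp R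
    have h5 : exp (-R) ≤ 1 := exp_le_one_iff.2 (by linarith)
    rw [sinh_eq]
    linarith
  have h4 : log (κ / 4) + R = log (κ * (exp R / 4)) := by
    rw [show κ * (exp R / 4) = κ / 4 * exp R by ring,
      log_mul (by positivity) (exp_pos R).ne', log_exp]
  have h5 : log (κ * (exp R / 4)) ≤ log (κ * sinh R) :=
    log_le_log (by positivity) (by gcongr)
  have h6 : (a * R + b) * (1 / (2 * a)) = R / 2 + b * (1 / (2 * a)) := by
    field_simp
  linarith

theorem le_of_ereal_log_lt {x R ε : ℝ} {s : ℝ≥0∞} (hx : 0 < x) (hR : 0 < R)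
    (hxs : ENNReal.ofReal x ≤ s) (h : ((1 / R : ℝ) : EReal) * ENNReal.log s < (ε : EReal)) :
    log x < R * ε := by
  have h1 : ((log x : ℝ) : EReal) ≤ ENNReal.log s := by
    rw [← ENNReal.log_ofReal_of_pos hx]
    exact ENNReal.log_le_log hxs
  have h2 : ((1 / R : ℝ) : EReal) * (log x : ℝ) < (ε : EReal) :=
    (mul_le_mul_of_nonneg_left h1 (by exact_mod_cast (one_div_pos.2 hR).le)).trans_lt h
  have h3 : 1 / R * log x < ε := by exact_mod_cast h2
  rwa [one_div, inv_mul_lt_iff₀ hR] at h3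

/-- The core of the argument: the rank bound on compact images in `T` passes to the boundary, since
otherwise some fibre of `g` would have exponential size. -/
theorem HasClosedRefinements.of_subexponentialPartition {X Y : Type u} {T : Type v}
    [MetricSpace X] [MetricSpace Y] [TopologicalSpace T] [T2Space T] [CompleteSpace Y]
    (hgeo : IsGeodesicSpace Y) (hY : TrianglesThinnerThan UpperHalfPlane Y) (y₀ : Y) {f : Y → X}
    (hf : Continuous f) (hqi : IsQuasiIsometricMap f) {g : X → T}
    (hg : IsSubexponentialPartition g) {m : ℕ}
    (hm : ∀ K : Set X, IsCompact K → HasClosedRefinements (g '' K) m)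
    {K : Set (BoundaryAtInfinity Y)} (hK : IsCompact K) : HasClosedRefinements K m := by
  obtain ⟨pr, hdist, hcont, hinj, hcontr, hmono, hnhds⟩ := hY.exists_radial_map hgeo y₀
  have : T2Space (BoundaryAtInfinity Y) :=
    T2Space.of_injective_continuous hinj (continuous_pi hcont)
  have : CompactSpace K := isCompact_iff_compactSpace.1 hK
  intro 𝒰 ho hcov
  by_contra hno
  -- A Lebesgue number expressed as a radius. It depends only on `𝒰`, so it stays fixed as `R`
  -- grows.
  obtain ⟨r, hr0, hr⟩ : ∃ r : ℝ≥0, 0 < r ∧ ∀ ξ : K, ∃ U ∈ 𝒰, ∀ η : K,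
      dist (pr η r) (pr ξ r) ≤ 1 → η ∈ U := by
    have h1 : ∀ ξ : K, ∃ U ∈ 𝒰, ∃ t, ∀ η : K, dist (pr η t) (pr ξ t) < 2 → η ∈ U := by
      intro ξ
      obtain ⟨U, hU, hξ⟩ := Set.mem_sUnion.1 (hcov ▸ Set.mem_univ ξ)
      obtain ⟨V, hV, rfl⟩ := isOpen_induced_iff.1 (ho U hU)
      obtain ⟨t, ht⟩ := hnhds V hV ξ hξ
      exact ⟨_, hU, t, fun η hη => ht η hη⟩
    choose U hU t ht using h1
    obtain ⟨s, hs⟩ := isCompact_univ.elim_finite_subcover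
      (fun ξ : K => {η : K | dist (pr η (t ξ)) (pr ξ (t ξ)) < 1})
      (fun ξ => isOpen_lt (((hcont _).comp continuous_subtype_val).dist continuous_const)
        continuous_const)
      (fun ξ _ => Set.mem_iUnion.2 ⟨ξ, by simp⟩)
    -- The summand `1` keeps `r`, and hence `sinh r`, positive; closeness at this time passes to
    -- every earlier `t ζ` by monotonicity.
    refine ⟨s.sup t + 1, by positivity, fun ξ => ?_⟩
    obtain ⟨ζ, hζs, hζ⟩ := Set.mem_iUnion₂.1 (hs (Set.mem_univ ξ))
    refine ⟨U ζ, hU ζ, fun η hη => ht ζ η ?_⟩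
    have h2 := hmono η ξ (t ζ) (s.sup t + 1) ((Finset.le_sup hζs).trans le_self_add)
    have h3 := dist_triangle (pr η (t ζ)) (pr ξ (t ζ)) (pr ζ (t ζ))
    have h4 : dist (pr ξ (t ζ)) (pr ζ (t ζ)) < 1 := hζ
    linarith
  -- If all fibre components on the sphere of radius `R` were small at radius `r`, the Hurewicz
  -- argument would refine `𝒰`.
  have hbig : ∀ R : ℝ≥0, ∃ (t : T) (F : Set K), IsPreconnected F ∧
      (∀ ξ ∈ F, g (f (pr ξ R)) = t) ∧ ∃ ξ ∈ F, ∃ η ∈ F, 1 < dist (pr η r) (pr ξ r) := by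
    intro R
    have hc : Continuous fun ξ : K => f (pr ξ R) :=
      hf.comp ((hcont R).comp continuous_subtype_val)
    let h : K → g '' Set.range fun ξ : K => f (pr ξ R) := fun ξ => ⟨_, _, ⟨ξ, rfl⟩, rfl⟩
    have hh : Continuous h := (hg.1.comp hc).subtype_mk _
    by_contra! hsmall
    refine hno ((hm _ (isCompact_range hc)).exists_refinement hh ho fun ξ => ?_)
    obtain ⟨U, hU, hξU⟩ := hr ξ
    refine ⟨U, hU, fun η hη => hξU η ?_⟩
    exact hsmall (h ξ) (connectedComponentIn (h ⁻¹' {h ξ}) ξ) isPreconnected_connectedComponentIn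
      (fun ζ hζ => by
        have hζ' : ζ ∈ h ⁻¹' {h ξ} := connectedComponentIn_subset _ _ hζ
        exact congrArg Subtype.val hζ') ξ
      (mem_connectedComponentIn rfl) η hη
  obtain ⟨a, b, ha, hb, hab⟩ := hqi
  have ha0 : 0 < a := by linarith
  obtain ⟨δ, hδ, hsub⟩ := hg.2 (f y₀)
  obtain ⟨N, hN⟩ := exists_isMaximalSeparatedNet X δ
  obtain ⟨σ₀, hσ₀⟩ := hsub δ le_rfl N hN
  set σ := max σ₀ δ
  have hσ : 0 < σ := hδ.trans_le (le_max_right _ _)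
  obtain ⟨R₀, hR₀, hR₀'⟩ := hσ₀ σ (le_max_left _ _) (le_max_right _ _) (1 / (2 * a))
    (by positivity)
  -- Points of `Y` whose images lie in one net ball are at most `D` apart.
  set D := a * (2 * σ + b)
  have hD : 0 < D := by positivity
  have hsr : 0 < sinh (r : ℝ) := sinh_pos_iff.2 (by exact_mod_cast hr0)
  have hsD : 0 < sinh (D / 2) := sinh_pos_iff.2 (by positivity)
  set κ := 1 / (2 * (sinh r * sinh (D / 2)))
  have hκ : 0 < κ := by positivity
  obtain ⟨R, hlog, hRr, hRR⟩ := ((eventually_le_log_mul_sinh b ha0 hκ).and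
    ((eventually_ge_atTop (r : ℝ)).and (eventually_ge_atTop R₀))).exists
  have hRpos : 0 < R := by linarith
  lift R to ℝ≥0 using hRpos.le
  have hsR : 0 < sinh (R : ℝ) := sinh_pos_iff.2 hRpos
  obtain ⟨t, F, hF, hFt, ξ, hξ, η, hη, hξη⟩ := hbig R
  -- The image of the `R`-sphere lies in the ball of radius `a * R + b`; the choice `ε = 1 / (2 *
  -- a)` compensates for the factor `a`.
  have haR : R₀ ≤ a * R + b := by nlinarith
  refine absurd (le_of_ereal_log_lt (x := κ * sinh R) (by positivity) (by linarith) ?_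
    (hR₀' _ haR t)) (not_lt.2 hlog)
  have hw : 0 < 2 * (sinh r * sinh (D / 2)) / sinh R := by positivity
  refine le_trans (ENNReal.ofReal_le_ofReal ?_) (hF.ofReal_dist_div_le_encard
    (p := fun ξ => pr ξ r) ((hcont r).comp continuous_subtype_val)
    (V := fun x => {ζ : K | f (pr ζ R) ∈ Metric.ball x σ}) (fun ζ hζ => ?_) hw
    (fun x _ ζ hζ ζ' hζ' => ?_) hη hξ)
  · rw [le_div_iff₀ hw]
    have : κ * sinh R * (2 * (sinh r * sinh (D / 2)) / sinh R) = 1 := by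
      simp only [κ]
      field_simp
    linarith
  · obtain ⟨x, hx, hζx⟩ := hN.exists_dist_lt hδ (f (pr ζ R))
    have hζx' : f (pr ζ R) ∈ Metric.ball x σ := hζx.trans_le (le_max_right _ _)
    refine ⟨x, ⟨hx, f (pr ζ R), hζx', hFt ζ hζ, ?_⟩, hζx'⟩
    have := (hab (pr ζ R) y₀).2
    rwa [hdist] at this
  · have h1 : dist (f (pr ζ R)) (f (pr ζ' R)) < 2 * σ := by
      have h2 := dist_triangle_right (f (pr ζ R)) (f (pr ζ' R)) x
      have h3 := Metric.mem_ball.1 hζ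
      have h4 := Metric.mem_ball.1 hζ'
      linarith
    have h2 : dist (pr ζ R) (pr ζ' R) ≤ D := by
      have h3 := (hab (pr ζ R) (pr ζ' R)).1
      have h4 : 1 / a * dist (pr ζ R) (pr ζ' R) ≤ 2 * σ + b := by linarith
      rwa [one_div, inv_mul_le_iff₀ ha0] at h4
    have h3 := hcontr ζ ζ' r R (by exact_mod_cast hRr) (by exact_mod_cast hRpos)
    have h4 : sinh (r : ℝ) / sinh R * sinh (dist (pr ζ R) (pr ζ' R) / 2) ≤
        sinh r / sinh R * sinh (D / 2) :=
      mul_le_mul_of_nonneg_left (sinh_le_sinh.2 (by linarith)) (by positivity)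
    have h5 : dist (pr ζ r) (pr ζ' r) / 2 ≤ sinh (dist (pr ζ r) (pr ζ' r) / 2) :=
      self_le_sinh_iff.2 (by positivity)
    have h6 : 2 * (sinh r * sinh (D / 2)) / sinh R = 2 * (sinh r / sinh R * sinh (D / 2)) := by
      ring
    rw [h6]
    linarith

theorem zero_le_coverDim (K : Type u) [TopologicalSpace K] [Nonempty K] : 0 ≤ coverDim K := by
  rw [coverDim, if_neg (not_isEmpty_iff.2 ‹_›)]
  exact le_iInf₂ fun n _ => by exact_mod_cast Nat.zero_le n

theorem coverDim_le_natCast_iff {K : Type u} [TopologicalSpace K] {n : ℕ} :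
    coverDim K ≤ ((n : ℕ∞) : WithBot ℕ∞) ↔ HasClosedRefinements K (n + 1) := by
  rcases isEmpty_or_nonempty K with hK | hK
  · rw [coverDim, if_pos hK]
    exact ⟨fun _ _ _ _ =>
      ⟨∅, Set.finite_empty, by simp, Subsingleton.elim _ _, by simp, isEmptyElim⟩,
      fun _ => bot_le⟩
  · rw [coverDim, if_neg (not_isEmpty_iff.2 hK)]
    refine ⟨fun h => ?_, fun h => iInf₂_le n h⟩
    have h1 : ((n : ℕ∞) : WithBot ℕ∞) < ((n + 1 : ℕ) : ℕ∞) := by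
      exact_mod_cast Nat.lt_succ_self n
    obtain ⟨k, hk⟩ := iInf_lt_iff.1 (h.trans_lt h1)
    obtain ⟨hk', hk⟩ := iInf_lt_iff.1 hk
    have h2 : k < n + 1 := by exact_mod_cast hk
    exact hk'.mono (by omega)

/-- The QPC property supplies a continuous map parallel to `f`, still quasi-isometric with additive
constant `b + 2 * C`. -/
theorem hyperbolicRank_le_partitionRank {X : Type u} [MetricSpace X] (hX : IsQPC X) {T : Type v}
    [TopologicalSpace T] [T2Space T] {g : X → T} (hg : IsSubexponentialPartition g) :
    hyperbolicRank X ≤ partitionRank g := by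
  refine iSup_le fun Y => iSup_le fun _ => iSup_le fun hY => iSup_le fun ⟨f, hqi⟩ =>
    iSup₂_le fun K hK => ?_
  rcases isEmpty_or_nonempty K with hKe | ⟨⟨ξ, -⟩⟩
  · rw [coverDim, if_pos hKe]
    exact bot_le
  obtain ⟨c, -⟩ := Quotient.exists_rep ξ
  have y₀ : Y := c.1 0
  obtain ⟨f', hf', C, hC⟩ := hX Y f hqi
  have hqi' : IsQuasiIsometricMap f' := by
    obtain ⟨a, b, ha, hb, hab⟩ := hqi
    have hC0 : 0 ≤ C := dist_nonneg.trans (hC y₀)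
    refine ⟨a, b + 2 * C, ha, by positivity, fun y y' => ?_⟩
    have h1 := hab y y'
    have h2 := dist_triangle4 (f' y) (f y) (f y') (f' y')
    have h3 := dist_triangle4 (f y) (f' y) (f' y') (f y')
    have h4 := hC y
    have h5 := hC y'
    rw [dist_comm (f y') (f' y')] at h2
    rw [dist_comm (f y) (f' y)] at h3
    exact ⟨by linarith [h1.1], by linarith [h1.2]⟩
  have hle : ∀ K' : Set X, IsCompact K' → coverDim (g '' K') ≤ partitionRank g := fun K' hK' =>
    le_iSup₂_of_le K' hK' le_rfl
  -- The image of one point excludes the value `⊥`, leaving `⊤` or a natural number.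
  have h0 : 0 ≤ partitionRank g := by
    have : Nonempty (g '' {f y₀}) := ⟨⟨_, f y₀, rfl, rfl⟩⟩
    exact (zero_le_coverDim _).trans (hle {f y₀} isCompact_singleton)
  generalize partitionRank g = ρ at hle h0
  induction ρ using WithBot.recBotCoe with
  | bot => simp at h0
  | coe ρ =>
    induction ρ using ENat.recTopCoe with
    | top => exact le_top
    | coe n =>
      have := hY.hadamard.1
      exact coverDim_le_natCast_iff.2 (HasClosedRefinements.of_subexponentialPartition
        hY.catNegOne.1 hY.catNegOne.2 y₀ hf' hqi' hg
        (fun K' hK' => coverDim_le_natCast_iff.1 (hle K' hK')) hK)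

theorem IsQuasiIsometricMap.comp {X Y Z : Type u} [MetricSpace X] [MetricSpace Y] [MetricSpace Z]
    {f : Y → Z} {e : X → Y} (hf : IsQuasiIsometricMap f) (he : IsQuasiIsometricMap e) :
    IsQuasiIsometricMap (f ∘ e) := by
  obtain ⟨a, b, ha, hb, hab⟩ := hf
  obtain ⟨a', b', ha', hb', hab'⟩ := he
  refine ⟨a * a', a * b' + b, one_le_mul_of_one_le_of_one_le ha ha', by positivity,
    fun x x' => ?_⟩
  obtain ⟨h1, h2⟩ := hab (e x) (e x')
  obtain ⟨h3, h4⟩ := hab' x x'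
  have ha0 : 0 < a := by linarith
  constructor
  · have h5 := mul_le_mul_of_nonneg_left h3 (one_div_pos.2 ha0).le
    have h6 : 1 / a * (1 / a' * dist x x' - b') =
        1 / (a * a') * dist x x' - 1 / a * b' := by
      rw [one_div_mul_one_div_rev a' a |>.symm]
      ring
    have h7 : 1 / a * b' ≤ a * b' :=
      mul_le_mul_of_nonneg_right (((div_le_one ha0).2 ha).trans ha) hb'
    simp only [Function.comp]
    linarith
  · have h5 := mul_le_mul_of_nonneg_left h4 ha0.le
    simp only [Function.comp]
    linarith

theorem QuasiIsometric.hyperbolicRank_le {X Z : Type u} [MetricSpace X] [MetricSpace Z]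
    (h : QuasiIsometric X Z) : hyperbolicRank X ≤ hyperbolicRank Z := by
  obtain ⟨e, he, -⟩ := h
  refine iSup_le fun Y => iSup_le fun iY => iSup_le fun hY => iSup_le fun ⟨f, hf⟩ => ?_
  exact le_iSup_of_le Y (le_iSup_of_le iY (le_iSup_of_le hY
    (le_iSup_of_le ⟨e ∘ f, he.comp hf⟩ le_rfl)))

/-- Since corank is a supremum, it suffices to bound the partitions of the QPC representative `Z`.
-/
theorem hyperbolicRank_le_corank {X : Type u} [MetricSpace X]
    (hX : ∃ (Z : Type u) (_ : MetricSpace Z), IsQPC Z ∧ QuasiIsometric X Z) :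
    hyperbolicRank X ≤ corank X := by
  obtain ⟨Z, iZ, hZ, hXZ⟩ := hX
  refine le_trans ?_ (le_iSup_of_le Z (le_iSup_of_le iZ (le_iSup_of_le hXZ le_rfl)))
  exact le_iInf fun T => le_iInf fun _ => le_iInf fun _ => le_iInf fun g => le_iInf fun hg =>
    hXZ.hyperbolicRank_le.trans (hyperbolicRank_le_partitionRank hZ hg)

end Main

theorem theorem1 (X : Type u) [MetricSpace X]
    (hX : ∃ (Z : Type u) (_ : MetricSpace Z), IsQPC Z ∧ QuasiIsometric X Z) :
    hyperbolicRank X ≤ corank X ∧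
    (∀ (Y : Type u) [MetricSpace Y], IsLocallyCompactHadamardCATNegOne Y →
      corank X < topDim (BoundaryAtInfinity Y) →
      ¬ ∃ f : Y → X, IsQuasiIsometricMap f) ∧
    (IsQPC X → ∀ (T : Type v) [TopologicalSpace T] [T2Space T] (g : X → T),
      IsSubexponentialPartition g → ¬ partitionRank g < hyperbolicRank X) := by
  refine ⟨hyperbolicRank_le_corank hX, fun Y iY hY hlt hf => ?_, fun hQ T _ _ g hg =>
    not_lt.2 (hyperbolicRank_le_partitionRank hQ hg)⟩
  refine absurd (hyperbolicRank_le_corank hX) (not_le.2 (hlt.trans_le ?_))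
  exact le_iSup_of_le Y (le_iSup_of_le iY (le_iSup_of_le hY (le_iSup_of_le hf le_rfl)))
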